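/- Theorem. Let $E$ be an Archimedean real vector lattice (i.e. if $x,y\in E$ and $nx\le y$ for all $n\in\mathbb N$, then $x\le 0$), and let $F$ be a vector sublattice of $E$ (a linear subspace closed under the lattice operations of $E$) which is order dense in $E$: for every $x\in E$ with $x>0$ there is $y\in F$ with $0<y\le x$. A vector lattice is said to have the countable sup property if every nonempty subset that possesses a supremum in the lattice contains a countable subset possessing the same supremum. Suppose that $F$ (with the order and lattice operations induced from $E$) has the countable sup property. Then $E$ has the countable sup property in each of the following cases: (a) $F$ is majorizing in $E$, i.e. for every $x\in E$ there is $y\in F$ with $x\le y$; (b) $F$ has a weak unit, i.e. there is $e\in F$ with $e\ge 0$ such that for $x\in F$, $|x|\wedge e=0$ implies $x=0$. -/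

import Mathlib

/-- `E` is Archimedean in the sense of ordered vector spaces: if the multiples `n • x`, `n ∈ ℕ`,
are all bounded above by one `y`, then `x ≤ 0`.  (Mathlib's class `Archimedean` is a different
notion: it forces every `x > 0` to be a strong unit.) -/
def IsArchimedeanOrdered (E : Type*) [AddCommGroup E] [Preorder E] : Prop :=
  ∀ x y : E, (∀ n : ℕ, n • x ≤ y) → x ≤ 0

/-- Every nonempty subset possessing a supremum contains a countable subset possessing the same
supremum. -/
def HasCountableSupProperty (E : Type*) [Preorder E] : Prop :=
  ∀ (S : Set E) (x : E), S.Nonempty → IsLUB S x → ∃ T ⊆ S, T.Countable ∧ IsLUB T x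

section VectorSublattice

variable {E : Type*} [AddCommGroup E] [Lattice E] [Module ℝ E]

/-- A vector sublattice: a linear subspace closed under the binary suprema and infima of `E`. -/
def IsVectorSublattice (F : Submodule ℝ E) : Prop :=
  IsSublattice (F : Set E)

/-- `F` is order dense in `E`: below every `x > 0` of `E` there is some `y > 0` of `F`. -/
def IsOrderDense (F : Submodule ℝ E) : Prop :=
  ∀ x : E, 0 < x → ∃ y ∈ F, 0 < y ∧ y ≤ x

/-- `F` is majorizing in `E`: every element of `E` lies below some element of `F`. -/
def IsMajorizing (F : Submodule ℝ E) : Prop :=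
  ∀ x : E, ∃ y ∈ F, x ≤ y

/-- `e` is a weak unit of the vector sublattice `F`; the lattice operations of `F` are the
restrictions of those of `E`.  Only `x` in `F` are tested. -/
def IsWeakUnitOf (F : Submodule ℝ E) (e : E) : Prop :=
  e ∈ F ∧ 0 ≤ e ∧ ∀ x ∈ F, |x| ⊓ e = 0 → x = 0

end VectorSublattice

/-!
An order dense subgroup `F` detects suprema: an upper bound `x` of `T` is its supremum as soon as
no `z > 0` in `F` satisfies `s + z ≤ x` for all `s ∈ T`.  Hence suprema in `F` are suprema in `E`,
and, `E` being Archimedean, every `x ≥ 0` is the supremum of the elements of `F` in `[0, x]`.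
Thus, when `A ⊆ E₊` has a supremum in `F`, the elements of `F₊` below members of `A` have the same
supremum.  By the countable sup property of `F` countably many of them suffice, and so do countably
many members of `A`.

For an arbitrary `S` with supremum `x` and `0 ≤ y ∈ F`, this applies to the truncations
`(y - (x - s))⁺`, whose supremum is `y`.  The countable `T ⊆ S` so obtained has the property that
any `z ≥ 0` with `s + z ≤ x` for all `s ∈ T` is disjoint from `y`.  Such a `z` is zero
if `y` is a weak unit, or if `s₀ ∈ T` and `x - s₀ ≤ y`; hence `T ∪ {s₀}` has supremum `x` when `y`
is suitably chosen for some `s₀ ∈ S`.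
-/

/-- Order density of an arbitrary subset `D` of an ordered group, so that it applies to subgroups
as well as to the subspaces of `IsOrderDense`. -/
def IsOrderDenseSet {E : Type*} [Zero E] [Preorder E] (D : Set E) : Prop :=
  ∀ x : E, 0 < x → ∃ y ∈ D, 0 < y ∧ y ≤ x

/-- Every interval `[0, x]` admits some `y ≥ 0` in `D` that is a weak unit for the elements of `D`
lying in it, a common weakening of having a weak unit and of being majorizing. -/
def HasLocalWeakUnits {E : Type*} [Zero E] [Lattice E] (D : Set E) : Prop :=
  ∀ x : E, 0 ≤ x → ∃ y ∈ D, 0 ≤ y ∧ ∀ z ∈ D, 0 ≤ z → z ≤ x → z ⊓ y = 0 → z = 0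

section LocalWeakUnits

variable {E : Type*} [AddCommGroup E] [Lattice E] [Module ℝ E] {F : Submodule ℝ E}

theorem IsMajorizing.hasLocalWeakUnits (hF : IsMajorizing F) :
    HasLocalWeakUnits (F : Set E) := by
  intro x hx
  obtain ⟨y, hyF, hxy⟩ := hF x
  exact ⟨y, hyF, hx.trans hxy, fun z _ _ hzx hzy => (inf_eq_left.2 (hzx.trans hxy)).symm.trans hzy⟩

theorem IsWeakUnitOf.hasLocalWeakUnits [IsOrderedAddMonoid E] {e : E} (he : IsWeakUnitOf F e) :
    HasLocalWeakUnits (F : Set E) := by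
  obtain ⟨heF, he₀, hunit⟩ := he
  exact fun _ _ => ⟨e, heF, he₀, fun z hzF hz _ hze => hunit z hzF (by rwa [abs_of_nonneg hz])⟩

end LocalWeakUnits

section LatticeOrderedGroup

variable {E : Type*} [AddCommGroup E] [Lattice E] [IsOrderedAddMonoid E]

theorem isLUB_image_posPart_sub {S : Set E} {x y : E} (hx : IsLUB S x) (hy : 0 ≤ y) :
    IsLUB ((fun s => (y - (x - s))⁺) '' S) y := by
  constructor
  · rintro _ ⟨s, hs, rfl⟩
    exact sup_le (sub_le_self y (sub_nonneg.2 (hx.1 hs))) hy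
  · intro u hu
    have hxu : x ≤ u - y + x := hx.2 fun s hs => by
      have hsu : y - (x - s) ≤ u := (le_posPart _).trans (hu (Set.mem_image_of_mem _ hs))
      calc s = y - (x - s) - y + x := by abel
        _ ≤ u - y + x := by gcongr
    exact sub_nonneg.1 (nonneg_of_le_add_left hxu)

namespace IsOrderDenseSet

theorem isLUB_of_forall_add_le {D : Set E} (hD : IsOrderDenseSet D) {T : Set E} {x : E}
    (hx : x ∈ upperBounds T) (h : ∀ z ∈ D, 0 ≤ z → (∀ s ∈ T, s + z ≤ x) → z ≤ 0) :
    IsLUB T x := by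
  refine ⟨hx, fun u hu => ?_⟩
  by_contra hxu
  have hgap : 0 < x - u ⊓ x := sub_pos.2 (inf_lt_right.2 hxu)
  obtain ⟨z, hzD, hz, hzx⟩ := hD _ hgap
  refine hz.not_ge (h z hzD hz.le fun s hs => ?_)
  calc s + z ≤ u ⊓ x + (x - u ⊓ x) := add_le_add (le_inf (hu hs) (hx hs)) hzx
    _ = x := add_sub_cancel _ _

theorem isLUB_nonneg_le {M : AddSubmonoid E} (hM : IsOrderDenseSet (M : Set E))
    (hE : IsArchimedeanOrdered E) {x : E} (hx : 0 ≤ x) :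
    IsLUB {b | b ∈ M ∧ 0 ≤ b ∧ b ≤ x} x := by
  refine hM.isLUB_of_forall_add_le (fun _ hb => hb.2.2) fun z hzM hz hadd => hE z x fun n => ?_
  induction n with
  | zero => simpa only [zero_nsmul] using hx
  | succ n ih =>
    rw [succ_nsmul]
    exact hadd _ ⟨nsmul_mem hzM n, nsmul_nonneg hz n, ih⟩

variable {F : AddSubgroup E}

theorem isLUB_image_coe (hF : IsOrderDenseSet (F : Set E)) {B : Set F} {a : F}
    (ha : IsLUB B a) : IsLUB ((↑) '' B : Set E) a := by
  refine hF.isLUB_of_forall_add_le (Set.forall_mem_image.2 fun _ hb => ha.1 hb)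
    fun z hzF _ hadd => ?_
  have haz : a ≤ a - ⟨z, hzF⟩ := ha.2 fun b hb =>
    le_sub_iff_add_le.2 (hadd b (Set.mem_image_of_mem _ hb))
  exact (le_sub_self_iff (a : E)).1 haz

theorem exists_countable_isLUB_of_nonneg (hF : IsOrderDenseSet (F : Set E))
    (hE : IsArchimedeanOrdered E) (hcsp : HasCountableSupProperty F) {A : Set E} {a : E}
    (hA : A.Nonempty) (hA₀ : ∀ s ∈ A, 0 ≤ s) (ha : IsLUB A a) (haF : a ∈ F) :
    ∃ T ⊆ A, T.Countable ∧ IsLUB T a := by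
  let B : Set F := {b | 0 ≤ (b : E) ∧ ∃ s ∈ A, (b : E) ≤ s}
  have hB : IsLUB B ⟨a, haF⟩ := by
    refine ⟨fun b ⟨_, s, hs, hbs⟩ => hbs.trans (ha.1 hs), fun u hu => ha.2 fun s hs => ?_⟩
    exact (isLUB_nonneg_le (M := F.toAddSubmonoid) hF hE (hA₀ s hs)).2
      fun b ⟨hbF, hb, hbs⟩ => hu (show ⟨b, hbF⟩ ∈ B from ⟨hb, s, hs, hbs⟩)
  obtain ⟨s₀, hs₀⟩ := hA
  obtain ⟨C, hCB, hC, hCa⟩ := hcsp B _ ⟨0, le_rfl, s₀, hs₀, hA₀ s₀ hs₀⟩ hB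
  choose! f hfA hle using fun b (hb : b ∈ C) => (hCB hb).2
  have hfCA : f '' C ⊆ A := Set.image_subset_iff.2 hfA
  refine ⟨f '' C, hfCA, hC.image f, fun s hs => ha.1 (hfCA hs), fun u hu => ?_⟩
  exact (hF.isLUB_image_coe hCa).2 <| Set.forall_mem_image.2 fun b hb =>
    (hle b hb).trans (hu (Set.mem_image_of_mem f hb))

theorem exists_countable_forall_inf_eq_zero (hF : IsOrderDenseSet (F : Set E))
    (hE : IsArchimedeanOrdered E) (hcsp : HasCountableSupProperty F) {S : Set E} {x y : E}
    (hS : S.Nonempty) (hx : IsLUB S x) (hyF : y ∈ F) (hy : 0 ≤ y) :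
    ∃ T ⊆ S, T.Countable ∧ ∀ z, 0 ≤ z → (∀ s ∈ T, s + z ≤ x) → z ⊓ y = 0 := by
  obtain ⟨A, hAS, hA, hAy⟩ := hF.exists_countable_isLUB_of_nonneg hE hcsp (hS.image _)
    (Set.forall_mem_image.2 fun _ _ => posPart_nonneg _) (isLUB_image_posPart_sub hx hy) hyF
  obtain ⟨T, hTS, hinj, rfl⟩ := Set.SurjOn.exists_subset_injOn_image_eq hAS
  refine ⟨T, hTS, Set.countable_of_injective_of_countable_image hinj hA,
    fun z hz hadd => le_antisymm ?_ (le_inf hz hy)⟩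
  have hyz : y ≤ y - z ⊓ y := hAy.2 <| Set.forall_mem_image.2 fun s hs => by
    have hzs : z ≤ x - s := le_sub_iff_add_le'.2 (hadd s hs)
    exact sup_le (sub_le_sub_left (inf_le_left.trans hzs) y) (sub_nonneg.2 inf_le_right)
  exact (le_sub_self_iff y).1 hyz

end IsOrderDenseSet

end LatticeOrderedGroup

theorem mainTheorem5_general {E : Type*} [AddCommGroup E] [Lattice E] [IsOrderedAddMonoid E]
    (hE : IsArchimedeanOrdered E) (F : AddSubgroup E) (hdense : IsOrderDenseSet (F : Set E))
    (hcsp : HasCountableSupProperty F) (hunit : HasLocalWeakUnits (F : Set E)) :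
    HasCountableSupProperty E := by
  intro S x hS hx
  have ⟨s₀, hs₀⟩ := hS
  obtain ⟨y, hyF, hy, hy_unit⟩ := hunit (x - s₀) (sub_nonneg.2 (hx.1 hs₀))
  obtain ⟨T, hTS, hT, hdisj⟩ := hdense.exists_countable_forall_inf_eq_zero hE hcsp hS hx hyF hy
  have hsub : insert s₀ T ⊆ S := Set.insert_subset hs₀ hTS
  refine ⟨insert s₀ T, hsub, hT.insert s₀,
    hdense.isLUB_of_forall_add_le (fun _ hs => hx.1 (hsub hs)) fun z hzF hz hadd => ?_⟩
  have hzx : z ≤ x - s₀ := le_sub_iff_add_le'.2 (hadd s₀ (Set.mem_insert s₀ T))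
  have hzy : z ⊓ y = 0 := hdisj z hz fun s hs => hadd s (Set.mem_insert_of_mem s₀ hs)
  exact (hy_unit z hzF hz hzx hzy).le

theorem mainTheorem5 {E : Type*} [AddCommGroup E] [Lattice E] [IsOrderedAddMonoid E]
    [Module ℝ E] [IsOrderedModule ℝ E] (hE : IsArchimedeanOrdered E)
    (F : Submodule ℝ E) (hF : IsVectorSublattice F) (hdense : IsOrderDense F)
    (hcsp : HasCountableSupProperty F) :
    (IsMajorizing F → HasCountableSupProperty E) ∧
      ((∃ e : E, IsWeakUnitOf F e) → HasCountableSupProperty E) := by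
  have general := mainTheorem5_general hE F.toAddSubgroup hdense hcsp
  exact ⟨fun hmaj => general hmaj.hasLocalWeakUnits, fun ⟨_, he⟩ => general he.hasLocalWeakUnits⟩
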